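/- Let $M_0,K_0,N_0\ge 1$ and let $\langle U,V,W\rangle$ be a bilinear algorithm of rank $R$ for multiplying an $M_0\times K_0$ matrix by a $K_0\times N_0$ matrix: $U=(u_{ir})$, $V=(v_{jr})$, $W=(w_{kr})$ are real matrices of dimensions $M_0K_0\times R$, $K_0N_0\times R$, $M_0N_0\times R$, and for all real $A\in\mathbb R^{M_0\times K_0}$, $B\in\mathbb R^{K_0\times N_0}$ the product $C=AB$ satisfies $$c_k=\sum_{r=1}^R w_{kr}\Big(\sum_{i} u_{ir}a_i\Big)\Big(\sum_{j} v_{jr}b_j\Big)\qquad(1\le k\le M_0N_0),$$ where entries of $A$ and $B$ are indexed in column-major order and entries of $C$ in row-major order. Let $\alpha_r,\beta_r$ be the numbers of nonzeros of column $r$ of $U$ and of $V$, $\gamma_k$ the number of nonzeros of row $k$ of $W$, $a_r=\sum_i|u_{ir}|$, $b_r=\sum_j|v_{jr}|$, and let $$Q=\max_k\Big(\gamma_k+\max_r\,(\alpha_r+\beta_r)\,\mathbb I(w_{kr}\ne0)\Big),\qquad E=\max_k\sum_{r=1}^R a_r b_r|w_{kr}| .$$ Let $L\ge0$ and let $M,K,N$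 be divisible by $M_0^L,K_0^L,N_0^L$ respectively. For $A\in\mathbb R^{M\times K}$ and $B\in\mathbb R^{K\times N}$, a product is computed in rounded arithmetic of precision $\epsilon$ by $L$ recursive steps of $\langle U,V,W\rangle$. If $L=0$, the classical algorithm is used: each entry is the sum $\sum_t a_{pt}b_{tq}$. If $L\ge1$, $A$ and $B$ are partitioned into $M_0\times K_0$ and $K_0\times N_0$ arrays of equally sized contiguous blocks $A_i$, $B_j$ (indexed in column-major order), the matrices $S_r=\sum_i u_{ir}A_i$ and $T_r=\sum_j v_{jr}B_j$ are computed, $M_r=S_rT_r$ is computed recursively with $L-1$ steps, and the blocks $C_k=\sum_r w_{kr}M_r$ (indexed in row-major order) are computed. Every scalar multiplication and addition with exact result $x$ returns some $x(1+\theta)$ with $|\theta|<\epsilon$ ($\theta$ may differ from operation to operation). Every sum of products is evaluated by sequential summation in index order: each product is rounded, and the products are accumulated one at a time starting from the first, with one rounding per addition; in the sums forming $S_r,T_r,C_k$ the terms with zero coefficient are omitted, and an empty sum is $0$. Then there is a constant $c$, depending only on $\langle U,V,W\rangle$, $L$, $M$, $K$, $N$, such that for all $A\in\mathbb R^{M\times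 K}$, $B\in\mathbb R^{K\times N}$, all $0<\epsilon<1$, and every matrix $\hat C$ that can result from this computation, $$\|\hat C-AB\|\le\Big(\frac{K}{K_0^L}+Q\,L\Big)\frac{K}{K_0^L}\,E^L\,\|A\|\,\|B\|\,\epsilon+c\,\|A\|\,\|B\|\,\epsilon^2,$$ where $\|\cdot\|$ is the max-norm (largest absolute value of an entry). -/

import Mathlib

/- The norm on matrices is the max-norm, the largest absolute value of an entry. -/
attribute [local instance] Matrix.normedAddCommGroup

noncomputable section

namespace FastMatMul

/-- Column-major indexing of the entries (or blocks) of an `m × n` array: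
`i ↦ (i % m, i / m)`. -/
def colMajor (m n : ℕ) : Fin (m * n) ≃ Fin m × Fin n :=
  (finCongr (Nat.mul_comm m n)).trans (finProdFinEquiv.symm.trans (Equiv.prodComm _ _))

/-- Row-major indexing of the entries (or blocks) of an `m × n` array:
`k ↦ (k / n, k % n)`. -/
def rowMajor (m n : ℕ) : Fin (m * n) ≃ Fin m × Fin n :=
  finProdFinEquiv.symm

/-- The coefficient matrices `⟨U, V, W⟩` of a bilinear algorithm of rank `R` for multiplying an
`M₀ × K₀` matrix by a `K₀ × N₀` matrix. -/
structure Coeffs (M₀ K₀ N₀ R : ℕ) where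
  U : Matrix (Fin (M₀ * K₀)) (Fin R) ℝ
  V : Matrix (Fin (K₀ * N₀)) (Fin R) ℝ
  W : Matrix (Fin (M₀ * N₀)) (Fin R) ℝ

variable {M₀ K₀ N₀ R : ℕ}

namespace Coeffs

/-- In exact arithmetic, `⟨U, V, W⟩` computes the product of an `M₀ × K₀` matrix and a
`K₀ × N₀` matrix. -/
def ComputesProduct (alg : Coeffs M₀ K₀ N₀ R) : Prop :=
  ∀ (A : Matrix (Fin M₀) (Fin K₀) ℝ) (B : Matrix (Fin K₀) (Fin N₀) ℝ) (k : Fin (M₀ * N₀)),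
    (A * B) (rowMajor M₀ N₀ k).1 (rowMajor M₀ N₀ k).2 =
      ∑ r : Fin R, alg.W k r *
        ((∑ i : Fin (M₀ * K₀), alg.U i r * A (colMajor M₀ K₀ i).1 (colMajor M₀ K₀ i).2) *
          (∑ j : Fin (K₀ * N₀), alg.V j r * B (colMajor K₀ N₀ j).1 (colMajor K₀ N₀ j).2))

/-- Number of nonzeros in column `r` of `U`. -/
def alpha (alg : Coeffs M₀ K₀ N₀ R) (r : Fin R) : ℕ :=
  ∑ i : Fin (M₀ * K₀), if alg.U i r ≠ 0 then 1 else 0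

/-- Number of nonzeros in column `r` of `V`. -/
def beta (alg : Coeffs M₀ K₀ N₀ R) (r : Fin R) : ℕ :=
  ∑ j : Fin (K₀ * N₀), if alg.V j r ≠ 0 then 1 else 0

/-- Number of nonzeros in row `k` of `W`. -/
def gamma (alg : Coeffs M₀ K₀ N₀ R) (k : Fin (M₀ * N₀)) : ℕ :=
  ∑ r : Fin R, if alg.W k r ≠ 0 then 1 else 0

/-- The 1-norm of column `r` of `U`. -/
def a (alg : Coeffs M₀ K₀ N₀ R) (r : Fin R) : ℝ :=
  ∑ i : Fin (M₀ * K₀), |alg.U i r|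

/-- The 1-norm of column `r` of `V`. -/
def b (alg : Coeffs M₀ K₀ N₀ R) (r : Fin R) : ℝ :=
  ∑ j : Fin (K₀ * N₀), |alg.V j r|

/-- The prefactor vector `q`. -/
def q (alg : Coeffs M₀ K₀ N₀ R) (k : Fin (M₀ * N₀)) : ℕ :=
  alg.gamma k +
    Finset.univ.sup fun r : Fin R =>
      (alg.alpha r + alg.beta r) * (if alg.W k r ≠ 0 then 1 else 0)

/-- The prefactor `Q`, the maximum of the prefactor vector. -/
def Q (alg : Coeffs M₀ K₀ N₀ R) : ℕ :=
  Finset.univ.sup alg.q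

/-- The stability vector `e`. -/
def e (alg : Coeffs M₀ K₀ N₀ R) (k : Fin (M₀ * N₀)) : ℝ :=
  ∑ r : Fin R, alg.a r * alg.b r * |alg.W k r|

/-- The stability factor `E`, the maximum of the stability vector. -/
def E (alg : Coeffs M₀ K₀ N₀ R) : ℝ :=
  ⨆ k : Fin (M₀ * N₀), alg.e k

end Coeffs

/-- The possible computed values, at precision `ε`, of an operation whose exact result is `x`:
all `x * (1 + θ)` with `|θ| < ε`. -/
def fl (ε x : ℝ) : Set ℝ :=
  {y | ∃ θ : ℝ, |θ| < ε ∧ y = x * (1 + θ)}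

/-- The possible computed values when the products `c * x` of the pairs `(c, x)` of a list are
rounded and added to `s` one at a time, with a rounding after each addition. -/
def flAccum (ε : ℝ) : ℝ → List (ℝ × ℝ) → Set ℝ
  | s, [] => {s}
  | s, (c, x) :: l => {z | ∃ p ∈ fl ε (c * x), ∃ t ∈ fl ε (s + p), z ∈ flAccum ε t l}

/-- The possible computed values of the sum of the products `c * x` over a list of pairs `(c, x)`,
by sequential summation. The accumulation starts from the first rounded product, so that `n`
pairs cost `n` multiplications and `n - 1` additions; the empty sum is exactly `0`. -/
def flDot (ε : ℝ) : List (ℝ × ℝ) → Set ℝ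
  | [] => {0}
  | (c, x) :: l => {z | ∃ p ∈ fl ε (c * x), z ∈ flAccum ε p l}

/-- The possible computed values of the linear combination `∑ i, c i * x i` by sequential
summation in the order of the index; terms whose coefficient is zero are not formed. -/
def flLinComb (ε : ℝ) {n : ℕ} (c x : Fin n → ℝ) : Set ℝ :=
  flDot ε (((List.finRange n).filter fun i => c i ≠ 0).map fun i => (c i, x i))

theorem block_index_lt {d D : ℕ} (i : Fin d) (p : Fin (D / d)) :
    (i : ℕ) * (D / d) + (p : ℕ) < D := by
  have h1 : ((i : ℕ) + 1) * (D / d) ≤ d * (D / d) := Nat.mul_le_mul_right _ i.isLt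
  have h2 : d * (D / d) ≤ D := Nat.mul_div_le D d
  have h3 := p.isLt
  have h4 : ((i : ℕ) + 1) * (D / d) = (i : ℕ) * (D / d) + D / d := by ring
  omega

/-- The submatrix in position `ij` of the partition of an `M × K` matrix into `m × k` contiguous
submatrices of size `(M / m) × (K / k)` (used when `m ∣ M` and `k ∣ K`). -/
def block {m k M K : ℕ} (X : Matrix (Fin M) (Fin K) ℝ) (ij : Fin m × Fin k) :
    Matrix (Fin (M / m)) (Fin (K / k)) ℝ :=
  fun p q => X ⟨(ij.1 : ℕ) * (M / m) + p, block_index_lt ij.1 p⟩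
    ⟨(ij.2 : ℕ) * (K / k) + q, block_index_lt ij.2 q⟩

/-- The possible computed products of the `M × K` matrix `A` and the `K × N` matrix `B`, in
rounded arithmetic of precision `ε`, by `L` recursive steps of the stationary algorithm
`⟨U, V, W⟩` followed by the classical algorithm.

At a recursive step, the computed `S r`, `T r` are linear combinations of the blocks of `A`, `B`,
each `P r` is a computed product of `S r` and `T r` with one recursive step less, and the blocks of
the result are computed linear combinations of the `P r`. -/
def fastMul (ε : ℝ) (alg : Coeffs M₀ K₀ N₀ R) : (L : ℕ) → {M K N : ℕ} →
    Matrix (Fin M) (Fin K) ℝ → Matrix (Fin K) (Fin N) ℝ → Set (Matrix (Fin M) (Fin N) ℝ)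
  | 0, _, K, _, A, B =>
      {C | ∀ p q, C p q ∈ flDot ε ((List.finRange K).map fun t => (A p t, B t q))}
  | L + 1, M, K, N, A, B =>
      {C | ∃ (S : Fin R → Matrix (Fin (M / M₀)) (Fin (K / K₀)) ℝ)
          (T : Fin R → Matrix (Fin (K / K₀)) (Fin (N / N₀)) ℝ)
          (P : Fin R → Matrix (Fin (M / M₀)) (Fin (N / N₀)) ℝ),
        (∀ r p q, S r p q ∈
          flLinComb ε (fun i => alg.U i r) (fun i => block A (colMajor M₀ K₀ i) p q)) ∧
        (∀ r p q, T r p q ∈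
          flLinComb ε (fun j => alg.V j r) (fun j => block B (colMajor K₀ N₀ j) p q)) ∧
        (∀ r, P r ∈ fastMul ε alg L (S r) (T r)) ∧
        (∀ k p q, block C (rowMajor M₀ N₀ k) p q ∈
          flLinComb ε (fun r => alg.W k r) (fun r => P r p q))}

end FastMatMul

end

namespace FastMatMul

variable {M₀ K₀ N₀ R : ℕ}

/-! The whole error is tracked as a factor `(1 + ε) ^ n - 1` times a magnitude, `n` counting the
roundings along one path through the algorithm; consecutive stages add their exponents, and nothing
is truncated until the end. By induction on `L` (`fastMul_error`), the exponent is `K / K₀ ^ L + Q *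
L` and the magnitude is `(K / K₀ ^ L) * E ^ L * ‖A‖ * ‖B‖`. A recursive step costs at most `α_r +
β_r + γ_k ≤ Q` roundings on any path with `W k r ≠ 0`, and scales magnitudes by `∑ a_r b_r |w_kr| ≤
E`. Errors in forming `S r`, `T r` pass through the exact product, of magnitude `K / K₀` rather than
`(K / K₀ ^ (L + 1)) * E ^ L`. The inequality `K₀ ≤ E` (`le_E`) absorbs the former into the latter.
-/

/-! ### Rounded sequential summation. -/

theorem fl_error {ε x y : ℝ} (h : y ∈ fl ε x) : |y - x| ≤ ε * |x| := by
  obtain ⟨θ, hθ, rfl⟩ := h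
  rw [show x * (1 + θ) - x = θ * x by ring, abs_mul]
  exact mul_le_mul_of_nonneg_right hθ.le (abs_nonneg x)

theorem abs_le_of_error {u v w : ℝ} (h : |u - v| ≤ w) : |u| ≤ |v| + w := by
  have := abs_sub_abs_le_abs_sub u v
  linarith

theorem list_sum_abs_nonneg (l : List (ℝ × ℝ)) : 0 ≤ (l.map fun a => |a.1 * a.2|).sum := by
  apply List.sum_nonneg
  simp only [List.mem_map]
  rintro _ ⟨a, -, rfl⟩
  exact abs_nonneg _

/-- The initial value meets one rounding per addition; each product meets its own rounding and at
most `l.length` additions. -/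
theorem flAccum_error {ε : ℝ} (hε : 0 ≤ ε) (l : List (ℝ × ℝ)) : ∀ {s z : ℝ}, z ∈ flAccum ε s l →
    |z - (s + (l.map fun a => a.1 * a.2).sum)| ≤
      ((1 + ε) ^ l.length - 1) * |s| +
        ((1 + ε) ^ (l.length + 1) - 1) * (l.map fun a => |a.1 * a.2|).sum := by
  induction l with
  | nil =>
    intro s z hz
    have hz : z = s := hz
    simp [hz]
  | cons a l ih =>
    obtain ⟨c, x⟩ := a
    rintro s z ⟨p, hp, t, ht, hz⟩
    have h := ih hz
    have hp := fl_error hp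
    have ht := fl_error ht
    have htri := abs_add_le s p
    have hp' := abs_le_of_error hp
    have ht' := abs_le_of_error ht
    have hG : 1 ≤ (1 + ε) ^ l.length := one_le_pow₀ (by linarith)
    have hsum := list_sum_abs_nonneg l
    simp only [List.map_cons, List.sum_cons, List.length_cons, pow_succ] at h ⊢
    generalize (l.map fun a => |a.1 * a.2|).sum = Y at *
    generalize (l.map fun a => a.1 * a.2).sum = X at *
    generalize (1 + ε) ^ l.length = G at *
    generalize c * x = y at *
    have hsp : |s + p| ≤ |s| + (1 + ε) * |y| := by linarith
    have htb : |t| ≤ (1 + ε) * (|s| + (1 + ε) * |y|) := by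
      nlinarith [mul_le_mul_of_nonneg_left hsp hε]
    have hm := mul_le_mul_of_nonneg_left htb (sub_nonneg.2 hG)
    have hm' := mul_le_mul_of_nonneg_left hsp hε
    -- The tail products get one more rounding than they incur, to share an exponent with the head.
    have hY : G * (1 + ε) * Y ≤ G * (1 + ε) * (1 + ε) * Y := by
      have : 0 ≤ G * (1 + ε) * ε * Y := by positivity
      linarith
    have htotal : |z - (s + (y + X))| ≤ |z - (t + X)| + |t - (s + p)| + |p - y| := by
      rw [show z - (s + (y + X)) = z - (t + X) + (t - (s + p)) + (p - y) by ring]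
      exact abs_add_three _ _ _
    linarith

/-- The first product enters without an addition, which saves one rounding: the exponent is
`l.length`. -/
theorem flDot_error {ε : ℝ} (hε : 0 ≤ ε) {l : List (ℝ × ℝ)} {z : ℝ} (hz : z ∈ flDot ε l) :
    |z - (l.map fun a => a.1 * a.2).sum| ≤
      ((1 + ε) ^ l.length - 1) * (l.map fun a => |a.1 * a.2|).sum := by
  cases l with
  | nil =>
    have hz : z = 0 := hz
    simp [hz]
  | cons a l =>
    obtain ⟨c, x⟩ := a
    obtain ⟨p, hp, hz⟩ := hz
    have h := flAccum_error hε l hz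
    have hp := fl_error hp
    have hp' := abs_le_of_error hp
    have hG : 1 ≤ (1 + ε) ^ l.length := one_le_pow₀ (by linarith)
    simp only [List.map_cons, List.sum_cons, List.length_cons, pow_succ] at h ⊢
    generalize (l.map fun a => |a.1 * a.2|).sum = Y at *
    generalize (l.map fun a => a.1 * a.2).sum = X at *
    generalize (1 + ε) ^ l.length = G at *
    generalize c * x = y at *
    have hm := mul_le_mul_of_nonneg_left hp' (sub_nonneg.2 hG)
    have htotal : |z - (y + X)| ≤ |z - (p + X)| + |p - y| := by
      rw [show z - (y + X) = z - (p + X) + (p - y) by ring]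
      exact abs_add_le _ _
    linarith

theorem sum_map_filter_finRange {n : ℕ} (P : Fin n → Prop) [DecidablePred P] (f : Fin n → ℝ)
    (hf : ∀ i, ¬ P i → f i = 0) :
    (((List.finRange n).filter fun i => P i).map f).sum = ∑ i, f i := by
  have h : ∀ l : List (Fin n), ((l.filter fun i => P i).map f).sum = (l.map f).sum := by
    intro l
    induction l with
    | nil => rfl
    | cons i l ih =>
      by_cases hi : P i
      · simp [hi, ih]
      · simp [hi, ih, hf i hi]
  rw [h, Fin.sum_univ_def]

theorem length_filter_finRange {n : ℕ} (P : Fin n → Prop) [DecidablePred P] :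
    ((List.finRange n).filter fun i => P i).length = ∑ i, if P i then 1 else 0 := by
  have h : ∀ l : List (Fin n),
      (l.filter fun i => P i).length = (l.map fun i => if P i then 1 else 0).sum := by
    intro l
    induction l with
    | nil => rfl
    | cons i l ih =>
      by_cases hi : P i
      · simp [hi, ih, add_comm]
      · simp [hi, ih]
  rw [h, Fin.sum_univ_def]

theorem flLinComb_error {ε : ℝ} (hε : 0 ≤ ε) {n : ℕ} {c x : Fin n → ℝ} {z : ℝ}
    (hz : z ∈ flLinComb ε c x) :
    |z - ∑ i, c i * x i| ≤
      ((1 + ε) ^ (∑ i, if c i ≠ 0 then 1 else 0) - 1) * ∑ i, |c i| * |x i| := by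
  have h := flDot_error hε hz
  rw [List.map_map, List.map_map, List.length_map, length_filter_finRange,
    sum_map_filter_finRange, sum_map_filter_finRange] at h
  · simpa only [Function.comp_apply, abs_mul] using h
  · intro i hi
    simp [not_not.1 hi]
  · intro i hi
    simp [not_not.1 hi]

theorem flLinComb_error_of_bound {ε : ℝ} (hε : 0 ≤ ε) {n : ℕ} {c x : Fin n → ℝ} {z y : ℝ}
    (hz : z ∈ flLinComb ε c x) (hx : ∀ i, |x i| ≤ y) :
    |z - ∑ i, c i * x i| ≤
      ((1 + ε) ^ (∑ i, if c i ≠ 0 then 1 else 0) - 1) * ((∑ i, |c i|) * y) := by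
  refine (flLinComb_error hε hz).trans (mul_le_mul_of_nonneg_left ?_
    (sub_nonneg.2 (one_le_pow₀ (by linarith))))
  rw [Finset.sum_mul]
  exact Finset.sum_le_sum fun i _ => mul_le_mul_of_nonneg_left (hx i) (abs_nonneg _)

theorem abs_sum_mul_le {ι : Type*} [Fintype ι] {c x : ι → ℝ} {y : ℝ} (hx : ∀ i, |x i| ≤ y) :
    |∑ i, c i * x i| ≤ (∑ i, |c i|) * y := by
  rw [Finset.sum_mul]
  refine (Finset.abs_sum_le_sum_abs _ _).trans (Finset.sum_le_sum fun i _ => ?_)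
  rw [abs_mul]
  exact mul_le_mul_of_nonneg_left (hx i) (abs_nonneg _)

/-! ### Blocks and the exact bilinear identity. -/

/-- Splitting `Fin D` into `d` contiguous blocks of length `D / d`. -/
def blockEquiv {d D : ℕ} (h : d ∣ D) : Fin d × Fin (D / d) ≃ Fin D :=
  finProdFinEquiv.trans (finCongr (Nat.mul_div_cancel' h))

theorem blockEquiv_apply {d D : ℕ} (h : d ∣ D) (i : Fin d) (p : Fin (D / d)) :
    blockEquiv h (i, p) = ⟨(i : ℕ) * (D / d) + p, block_index_lt i p⟩ := by
  ext
  simp [blockEquiv, finProdFinEquiv, mul_comm, add_comm]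

/-- With the position `s` inside the blocks as outer index, each inner sum is an entry of a product
of real `m × k` and `k × n` matrices, so `ComputesProduct` applies for each `s` separately. -/
theorem block_mul {m k n M K N : ℕ} (h : k ∣ K) (A : Matrix (Fin M) (Fin K) ℝ)
    (B : Matrix (Fin K) (Fin N) ℝ) (i : Fin m) (j : Fin n) (p : Fin (M / m)) (q : Fin (N / n)) :
    block (A * B) (i, j) p q =
      ∑ s : Fin (K / k), ∑ t : Fin k, block A (i, t) p s * block B (t, j) s q := by
  rw [Finset.sum_comm, ← Fintype.sum_prod_type', block, Matrix.mul_apply,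
    ← (blockEquiv h).sum_comp]
  refine Finset.sum_congr rfl fun x _ => ?_
  rw [← Prod.mk.eta (p := x), blockEquiv_apply]
  rfl

namespace Coeffs

theorem a_nonneg (alg : Coeffs M₀ K₀ N₀ R) (r : Fin R) : 0 ≤ alg.a r :=
  Finset.sum_nonneg fun _ _ => abs_nonneg _

theorem b_nonneg (alg : Coeffs M₀ K₀ N₀ R) (r : Fin R) : 0 ≤ alg.b r :=
  Finset.sum_nonneg fun _ _ => abs_nonneg _

theorem e_le_E (alg : Coeffs M₀ K₀ N₀ R) (k : Fin (M₀ * N₀)) : alg.e k ≤ alg.E :=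
  le_ciSup (Set.finite_range alg.e).bddAbove k

theorem gamma_add_le_Q (alg : Coeffs M₀ K₀ N₀ R) (k : Fin (M₀ * N₀)) (r : Fin R)
    (h : alg.W k r ≠ 0) : alg.gamma k + (alg.alpha r + alg.beta r) ≤ alg.Q := by
  refine le_trans ?_ (Finset.le_sup (f := alg.q) (Finset.mem_univ k))
  refine Nat.add_le_add_left ?_ _
  refine le_trans (by simp [h]) (Finset.le_sup (f := fun r : Fin R =>
      (alg.alpha r + alg.beta r) * (if alg.W k r ≠ 0 then 1 else 0)) (Finset.mem_univ r))

theorem ComputesProduct.block_mul_eq {alg : Coeffs M₀ K₀ N₀ R} (halg : alg.ComputesProduct)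
    {M K N : ℕ} (h : K₀ ∣ K) (A : Matrix (Fin M) (Fin K) ℝ) (B : Matrix (Fin K) (Fin N) ℝ)
    (k : Fin (M₀ * N₀)) (p : Fin (M / M₀)) (q : Fin (N / N₀)) :
    block (A * B) (rowMajor M₀ N₀ k) p q = ∑ r, alg.W k r * ∑ s,
      (∑ i, alg.U i r * block A (colMajor M₀ K₀ i) p s) *
        ∑ j, alg.V j r * block B (colMajor K₀ N₀ j) s q := by
  simp_rw [Finset.mul_sum (Finset.univ : Finset (Fin (K / K₀)))]
  rw [Finset.sum_comm, ← Prod.mk.eta (p := rowMajor M₀ N₀ k), block_mul h]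
  refine Finset.sum_congr rfl fun s _ => ?_
  exact halg (fun i t => block A (i, t) p s) (fun t j => block B (t, j) s q) k

/-- On all-ones matrices the product has entries `K₀`, while the triangle inequality bounds the
bilinear formula by `e k`. -/
theorem ComputesProduct.le_E {alg : Coeffs M₀ K₀ N₀ R} (halg : alg.ComputesProduct)
    (hM₀ : 0 < M₀) (hN₀ : 0 < N₀) : (K₀ : ℝ) ≤ alg.E := by
  let k : Fin (M₀ * N₀) := ⟨0, Nat.mul_pos hM₀ hN₀⟩
  have h := halg (Matrix.of fun _ _ => 1) (Matrix.of fun _ _ => 1) k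
  rw [Matrix.mul_apply] at h
  simp only [Matrix.of_apply, mul_one, Finset.sum_const, Finset.card_univ, Fintype.card_fin,
    nsmul_eq_mul] at h
  rw [h]
  refine le_trans (Finset.sum_le_sum fun r _ => ?_) (alg.e_le_E k)
  refine (le_abs_self _).trans ?_
  rw [abs_mul, abs_mul, mul_comm]
  exact mul_le_mul_of_nonneg_right (mul_le_mul (Finset.abs_sum_le_sum_abs _ _)
    (Finset.abs_sum_le_sum_abs _ _) (abs_nonneg _) (alg.a_nonneg r)) (abs_nonneg _)

end Coeffs

/-! ### Propagation of errors through the recursion. -/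

/-- Growth factors multiply under products, as `F * (G - 1) + (F - 1) = F * G - 1`. -/
theorem abs_mul_sub_mul_le {u v u' v' x y F G : ℝ} (hu : |u| ≤ x) (hv : |v| ≤ y)
    (hu' : |u' - u| ≤ (F - 1) * x) (hv' : |v' - v| ≤ (G - 1) * y) (hF : 1 ≤ F) :
    |u' * v' - u * v| ≤ (F * G - 1) * (x * y) := by
  have hx : 0 ≤ x := (abs_nonneg u).trans hu
  have hy : 0 ≤ y := (abs_nonneg v).trans hv
  have h₁ : |u'| ≤ F * x := by linarith [abs_le_of_error hu']
  have h₂ : |u'| * |v' - v| ≤ F * x * ((G - 1) * y) :=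
    mul_le_mul h₁ hv' (abs_nonneg _) (mul_nonneg (by linarith) hx)
  have h₃ : |u' - u| * |v| ≤ (F - 1) * x * y :=
    mul_le_mul hu' hv (abs_nonneg _) (mul_nonneg (by linarith) hx)
  have h₄ : |u' * v' - u * v| ≤ |u'| * |v' - v| + |u' - u| * |v| := by
    rw [← abs_mul, ← abs_mul, show u' * v' - u * v = u' * (v' - v) + (u' - u) * v by ring]
    exact abs_add_le _ _
  linarith

theorem abs_sum_sub_sum_le {n : ℕ} {f g : Fin n → ℝ} {y : ℝ} (h : ∀ i, |f i - g i| ≤ y) :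
    |∑ i, f i - ∑ i, g i| ≤ n * y := by
  rw [← Finset.sum_sub_distrib]
  refine (Finset.abs_sum_le_sum_abs _ _).trans ((Finset.sum_le_sum fun i _ => h i).trans ?_)
  simp

theorem abs_mul_apply_le {M K N : ℕ} {A : Matrix (Fin M) (Fin K) ℝ} {B : Matrix (Fin K) (Fin N) ℝ}
    {x y : ℝ} (hx : 0 ≤ x) (hA : ∀ p q, |A p q| ≤ x) (hB : ∀ p q, |B p q| ≤ y)
    (p : Fin M) (q : Fin N) : |(A * B) p q| ≤ K * (x * y) := by
  rw [Matrix.mul_apply]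
  refine (Finset.abs_sum_le_sum_abs _ _).trans ?_
  refine (Finset.sum_le_card_nsmul _ _ (x * y) fun t _ => ?_).trans (by simp)
  rw [abs_mul]
  exact mul_le_mul (hA p t) (hB t q) (abs_nonneg _) hx

theorem classical_error {ε : ℝ} (hε : 0 ≤ ε) {K : ℕ} {f g : Fin K → ℝ} {x y z : ℝ} (hx : 0 ≤ x)
    (hf : ∀ t, |f t| ≤ x) (hg : ∀ t, |g t| ≤ y)
    (hz : z ∈ flDot ε ((List.finRange K).map fun t => (f t, g t))) :
    |z - ∑ t, f t * g t| ≤ ((1 + ε) ^ K - 1) * (K * (x * y)) := by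
  have h := flDot_error hε hz
  rw [List.map_map, List.map_map, List.length_map, List.length_finRange,
    ← Fin.sum_univ_def, ← Fin.sum_univ_def] at h
  refine h.trans (mul_le_mul_of_nonneg_left ?_ (sub_nonneg.2 (one_le_pow₀ (by linarith))))
  refine (Finset.sum_le_card_nsmul _ _ (x * y) fun t _ => ?_).trans (by simp)
  simp only [Function.comp_apply, abs_mul]
  exact mul_le_mul (hf t) (hg t) (abs_nonneg _) hx

/-- The entrywise error of `L` recursive steps, with all orders of `ε` kept. -/
theorem fastMul_error (hM₀ : 0 < M₀) (hN₀ : 0 < N₀) {alg : Coeffs M₀ K₀ N₀ R}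
    (halg : alg.ComputesProduct) {ε : ℝ} (hε : 0 ≤ ε) (L : ℕ) :
    ∀ {M K N : ℕ}, M₀ ^ L ∣ M → K₀ ^ L ∣ K → N₀ ^ L ∣ N →
      ∀ {A : Matrix (Fin M) (Fin K) ℝ} {B : Matrix (Fin K) (Fin N) ℝ} {x y : ℝ},
        0 ≤ x → 0 ≤ y → (∀ p q, |A p q| ≤ x) → (∀ p q, |B p q| ≤ y) →
        ∀ C ∈ fastMul ε alg L A B, ∀ p q, |C p q - (A * B) p q| ≤
          ((1 + ε) ^ (K / K₀ ^ L + alg.Q * L) - 1) *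
            (((K / K₀ ^ L : ℕ) : ℝ) * alg.E ^ L * (x * y)) := by
  have hone : ∀ n : ℕ, 1 ≤ (1 + ε) ^ n := fun n => one_le_pow₀ (by linarith)
  have hE := halg.le_E hM₀ hN₀
  have hE0 : 0 ≤ alg.E := le_trans (Nat.cast_nonneg _) hE
  induction L with
  | zero =>
    intro M K N _ _ _ A B x y hx _ hA hB C hC p q
    simpa [Matrix.mul_apply] using
      classical_error hε hx (fun t => hA p t) (fun t => hB t q) (hC p q)
  | succ L ih =>
    intro M K N hM hK hN A B x y hx hy hA hB C hC p q
    rw [pow_succ'] at hM hK hN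
    have hM' : M₀ ∣ M := (Dvd.intro _ rfl).trans hM
    have hK' : K₀ ∣ K := (Dvd.intro _ rfl).trans hK
    have hN' : N₀ ∣ N := (Dvd.intro _ rfl).trans hN
    obtain ⟨S, T, P, hS, hT, hP, hC⟩ := hC
    obtain ⟨⟨i, p⟩, rfl⟩ := (blockEquiv hM').surjective p
    obtain ⟨⟨j, q⟩, rfl⟩ := (blockEquiv hN').surjective q
    obtain ⟨k, hk⟩ := (rowMajor M₀ N₀).surjective (i, j)
    rw [blockEquiv_apply, blockEquiv_apply]
    have hCk := hC k p q
    have hex := halg.block_mul_eq hK' A B k p q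
    rw [hk] at hCk hex
    change |block C (i, j) p q - block (A * B) (i, j) p q| ≤ _
    rw [hex, show K / K₀ ^ (L + 1) = K / K₀ / K₀ ^ L by rw [pow_succ', Nat.div_div_eq_div_mul]]
    have hKL : K₀ ^ L ∣ K / K₀ := (Nat.dvd_div_iff_mul_dvd hK').2 hK
    set κ := K / K₀ / K₀ ^ L with hκ
    set S₀ : Fin R → Matrix (Fin (M / M₀)) (Fin (K / K₀)) ℝ := fun r p s =>
      ∑ i, alg.U i r * block A (colMajor M₀ K₀ i) p s with hS₀
    set T₀ : Fin R → Matrix (Fin (K / K₀)) (Fin (N / N₀)) ℝ := fun r s q =>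
      ∑ j, alg.V j r * block B (colMajor K₀ N₀ j) s q with hT₀
    set Z : ℝ := (κ : ℝ) * alg.E ^ L with hZ
    have hZ0 : 0 ≤ Z := by positivity
    -- `K / K₀ = κ * K₀ ^ L`, and `K₀ ≤ E`.
    have hKZ : ((K / K₀ : ℕ) : ℝ) ≤ Z := by
      rw [← Nat.div_mul_cancel hKL, Nat.cast_mul, Nat.cast_pow]
      exact mul_le_mul_of_nonneg_left (pow_le_pow_left₀ (Nat.cast_nonneg _) hE L)
        (Nat.cast_nonneg _)
    have hS₀b : ∀ r p s, |S₀ r p s| ≤ alg.a r * x := fun r p s =>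
      abs_sum_mul_le fun _ => hA _ _
    have hT₀b : ∀ r s q, |T₀ r s q| ≤ alg.b r * y := fun r s q =>
      abs_sum_mul_le fun _ => hB _ _
    have hSe : ∀ r p s, |S r p s - S₀ r p s| ≤ ((1 + ε) ^ alg.alpha r - 1) * (alg.a r * x) :=
      fun r p s => flLinComb_error_of_bound hε (hS r p s) fun _ => hA _ _
    have hTe : ∀ r s q, |T r s q - T₀ r s q| ≤ ((1 + ε) ^ alg.beta r - 1) * (alg.b r * y) :=
      fun r s q => flLinComb_error_of_bound hε (hT r s q) fun _ => hB _ _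
    have hSb : ∀ r p s, |S r p s| ≤ (1 + ε) ^ alg.alpha r * (alg.a r * x) := fun r p s => by
      linarith [abs_le_of_error (hSe r p s), hS₀b r p s]
    have hTb : ∀ r s q, |T r s q| ≤ (1 + ε) ^ alg.beta r * (alg.b r * y) := fun r s q => by
      linarith [abs_le_of_error (hTe r s q), hT₀b r s q]
    have hxy : ∀ r, 0 ≤ alg.a r * x * (alg.b r * y) := fun r =>
      mul_nonneg (mul_nonneg (alg.a_nonneg r) hx) (mul_nonneg (alg.b_nonneg r) hy)
    have hST : ∀ r, |(S r * T r) p q - (S₀ r * T₀ r) p q| ≤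
        ((1 + ε) ^ (alg.alpha r + alg.beta r) - 1) * (Z * (alg.a r * x * (alg.b r * y))) := by
      intro r
      rw [Matrix.mul_apply, Matrix.mul_apply, pow_add]
      refine (abs_sum_sub_sum_le fun s => abs_mul_sub_mul_le (hS₀b r p s) (hT₀b r s q)
        (hSe r p s) (hTe r s q) (hone _)).trans ?_
      rw [← pow_add, mul_left_comm]
      exact mul_le_mul_of_nonneg_left (mul_le_mul_of_nonneg_right hKZ (hxy r))
        (sub_nonneg.2 (hone _))
    have hP₀ : ∀ r, |(S₀ r * T₀ r) p q| ≤ Z * (alg.a r * x * (alg.b r * y)) := fun r =>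
      (abs_mul_apply_le (mul_nonneg (alg.a_nonneg r) hx) (hS₀b r) (hT₀b r) p q).trans
        (mul_le_mul_of_nonneg_right hKZ (hxy r))
    have hPe : ∀ r, |P r p q - (S₀ r * T₀ r) p q| ≤
        ((1 + ε) ^ (κ + alg.Q * L + (alg.alpha r + alg.beta r)) - 1) *
          (Z * (alg.a r * x * (alg.b r * y))) := by
      intro r
      -- The induction hypothesis is used on the computed `S r`, `T r`, whose bounds carry the
      -- factors `(1 + ε) ^ α_r` and `(1 + ε) ^ β_r`; these add to the exponent.
      have h₁ := ih ((Nat.dvd_div_iff_mul_dvd hM').2 hM) hKL ((Nat.dvd_div_iff_mul_dvd hN').2 hN)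
        (mul_nonneg (by positivity) (mul_nonneg (alg.a_nonneg r) hx))
        (mul_nonneg (by positivity) (mul_nonneg (alg.b_nonneg r) hy))
        (hSb r) (hTb r) (P r) (hP r) p q
      have h₂ := abs_sub_le (P r p q) ((S r * T r) p q) ((S₀ r * T₀ r) p q)
      have h₃ := hST r
      rw [← hκ, ← hZ] at h₁
      rw [pow_add _ (alg.alpha r)] at h₃
      rw [pow_add _ (κ + alg.Q * L), pow_add _ (alg.alpha r)]
      linarith
    have hPb : ∀ r, |P r p q| ≤ (1 + ε) ^ (κ + alg.Q * L + (alg.alpha r + alg.beta r)) *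
        (Z * (alg.a r * x * (alg.b r * y))) := fun r => by
      linarith [abs_le_of_error (hPe r), hP₀ r]
    have hCe := flLinComb_error hε hCk
    change _ ≤ ((1 + ε) ^ alg.gamma k - 1) * _ at hCe
    have hterm : ∀ r, ((1 + ε) ^ alg.gamma k - 1) * (|alg.W k r| * |P r p q|) +
        |alg.W k r| * |P r p q - (S₀ r * T₀ r) p q| ≤
        ((1 + ε) ^ (κ + alg.Q * (L + 1)) - 1) * (Z * (x * y)) *
          (alg.a r * alg.b r * |alg.W k r|) := by
      intro r
      -- Zero coefficients contribute nothing, so the indicator in `Q` loses nothing.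
      by_cases hw : alg.W k r = 0
      · simp [hw]
      have h₁ := mul_le_mul_of_nonneg_left (hPb r) (sub_nonneg.2 (hone (alg.gamma k)))
      have h₂ : (1 + ε) ^ alg.gamma k * (1 + ε) ^ (κ + alg.Q * L + (alg.alpha r + alg.beta r)) ≤
          (1 + ε) ^ (κ + alg.Q * (L + 1)) := by
        rw [← pow_add]
        refine pow_le_pow_right₀ (by linarith) ?_
        have := alg.gamma_add_le_Q k r hw
        rw [mul_add, mul_one]
        omega
      have h₃ := mul_le_mul_of_nonneg_right h₂ (mul_nonneg hZ0 (hxy r))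
      have h₄ : ((1 + ε) ^ alg.gamma k - 1) * |P r p q| + |P r p q - (S₀ r * T₀ r) p q| ≤
          ((1 + ε) ^ (κ + alg.Q * (L + 1)) - 1) * (Z * (alg.a r * x * (alg.b r * y))) := by
        linarith [hPe r]
      have h₅ := mul_le_mul_of_nonneg_left h₄ (abs_nonneg (alg.W k r))
      linarith
    have hsum : |block C (i, j) p q - ∑ r, alg.W k r * (S₀ r * T₀ r) p q| ≤
        ∑ r, (((1 + ε) ^ alg.gamma k - 1) * (|alg.W k r| * |P r p q|) +
          |alg.W k r| * |P r p q - (S₀ r * T₀ r) p q|) := by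
      refine (abs_sub_le _ (∑ r, alg.W k r * P r p q) _).trans ?_
      rw [Finset.sum_add_distrib, ← Finset.mul_sum]
      refine add_le_add hCe ?_
      rw [← Finset.sum_sub_distrib]
      refine (Finset.abs_sum_le_sum_abs _ _).trans (Finset.sum_le_sum fun r _ => ?_)
      rw [← mul_sub, abs_mul]
    refine (hsum.trans (Finset.sum_le_sum fun r _ => hterm r)).trans ?_
    rw [← Finset.mul_sum, pow_succ alg.E]
    have h := mul_le_mul_of_nonneg_left (alg.e_le_E k)
      (mul_nonneg (sub_nonneg.2 (hone (κ + alg.Q * (L + 1))))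
        (mul_nonneg hZ0 (mul_nonneg hx hy)))
    refine h.trans (le_of_eq ?_)
    rw [hZ]
    ring

/-! ### Passage to first order in `ε`. -/

theorem one_add_pow_le {ε : ℝ} (h0 : 0 ≤ ε) (h1 : ε ≤ 1) (n : ℕ) :
    (1 + ε) ^ n ≤ 1 + n * ε + 4 ^ n * ε ^ 2 := by
  induction n with
  | zero => simp [sq_nonneg]
  | succ n ih =>
    have hn : (n : ℝ) ≤ 4 ^ n := by exact_mod_cast (Nat.lt_pow_self (by norm_num)).le
    have h4 : (0 : ℝ) < 4 ^ n := by positivity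
    have h := mul_le_mul_of_nonneg_right ih (by linarith : 0 ≤ 1 + ε)
    -- The new coefficient of `ε ^ 2` is at most `n + 4 ^ n + 4 ^ n ≤ 3 * 4 ^ n`.
    have h₂ : (n : ℝ) * ε ^ 2 ≤ 4 ^ n * ε ^ 2 := mul_le_mul_of_nonneg_right hn (sq_nonneg ε)
    have h₃ : 4 ^ n * ε ^ 2 * ε ≤ 4 ^ n * ε ^ 2 := mul_le_of_le_one_right (by positivity) h1
    have h₄ : 0 ≤ 4 ^ n * ε ^ 2 := by positivity
    rw [pow_succ, pow_succ (4 : ℝ)]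
    push_cast
    linarith

end FastMatMul

theorem theorem4p1 {M₀ K₀ N₀ R : ℕ} (hM₀ : 0 < M₀) (hK₀ : 0 < K₀) (hN₀ : 0 < N₀)
    (alg : FastMatMul.Coeffs M₀ K₀ N₀ R) (halg : alg.ComputesProduct)
    (L M K N : ℕ) (hM : M₀ ^ L ∣ M) (hK : K₀ ^ L ∣ K) (hN : N₀ ^ L ∣ N) :
    ∃ c : ℝ, ∀ (A : Matrix (Fin M) (Fin K) ℝ) (B : Matrix (Fin K) (Fin N) ℝ) (ε : ℝ),
      0 < ε → ε < 1 → ∀ C_hat ∈ FastMatMul.fastMul ε alg L A B,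
        ‖C_hat - A * B‖ ≤
          ((K : ℝ) / (K₀ : ℝ) ^ L + (alg.Q : ℝ) * (L : ℝ)) * ((K : ℝ) / (K₀ : ℝ) ^ L) *
            alg.E ^ L * ‖A‖ * ‖B‖ * ε + c * ‖A‖ * ‖B‖ * ε ^ 2 := by
  have hκ : ((K / K₀ ^ L : ℕ) : ℝ) = (K : ℝ) / (K₀ : ℝ) ^ L := by
    rw [Nat.cast_div hK (by positivity), Nat.cast_pow]
  have hE : 0 ≤ alg.E := le_trans (Nat.cast_nonneg _) (halg.le_E hM₀ hN₀)
  -- The quadratic remainder of `one_add_pow_le` times the magnitude from `fastMul_error`.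
  refine ⟨4 ^ (K / K₀ ^ L + alg.Q * L) * ((K / K₀ ^ L : ℕ) * alg.E ^ L), ?_⟩
  intro A B ε h0 h1 C hC
  rw [← hκ]
  have hb : (1 + ε) ^ (K / K₀ ^ L + alg.Q * L) - 1 ≤
      (((K / K₀ ^ L : ℕ) : ℝ) + alg.Q * L) * ε + 4 ^ (K / K₀ ^ L + alg.Q * L) * ε ^ 2 := by
    have := FastMatMul.one_add_pow_le h0.le h1.le (K / K₀ ^ L + alg.Q * L)
    push_cast only [Nat.cast_add, Nat.cast_mul] at this
    linarith
  refine (Matrix.norm_le_iff (by positivity)).2 fun p q => ?_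
  rw [Matrix.sub_apply, Real.norm_eq_abs]
  refine (FastMatMul.fastMul_error hM₀ hN₀ halg h0.le L hM hK hN (norm_nonneg A) (norm_nonneg B)
    (fun p q => Matrix.norm_entry_le_entrywise_sup_norm A)
    (fun p q => Matrix.norm_entry_le_entrywise_sup_norm B) C hC p q).trans ?_
  refine (mul_le_mul_of_nonneg_right hb (by positivity)).trans (le_of_eq ?_)
  ring
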